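/- Let $g \geq 1$, and let $\pi_1(\Sigma_g)$ be the fundamental group of a closed oriented surface of genus $g$, with its standard presentation \[\pi_1(\Sigma_g) = \langle x_1,\ldots,x_{2g} \mid [x_1,x_2][x_3,x_4]\cdots[x_{2g-1},x_{2g}] = 1\rangle,\] where $[y,z] = y^{-1}z^{-1}yz$ and $y^z = z^{-1}yz$. Then the commutator subgroup $[\pi_1(\Sigma_g),\pi_1(\Sigma_g)]$ is freely generated by the family of elements \[[x_i,x_j]^{x_i^{k_i}x_{i+1}^{k_{i+1}}\cdots x_{2g}^{k_{2g}}}, \qquad 1 \leq i < j \leq 2g,\ (i,j) \neq (1,2),\ k_i,k_{i+1},\ldots,k_{2g} \in \mathbb{Z}.\] (Different choices of $(i,j,k_i,\ldots,k_{2g})$ give different elements, and these elements form a free basis.) -/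

import Mathlib

/-- The commutator `[y, z] = y⁻¹ z⁻¹ y z`
(Mathlib's bracket `⁅y, z⁆` is `y z y⁻¹ z⁻¹`, so it is not used here). -/
def groupComm {G : Type*} [Group G] (y z : G) : G := y⁻¹ * z⁻¹ * y * z

/-- The conjugate `y ^ z = z⁻¹ y z`. -/
def groupConj {G : Type*} [Group G] (y z : G) : G := z⁻¹ * y * z

/-- The surface relator `[x₁, x₂] [x₃, x₄] ⋯ [x_{2g-1}, x_{2g}]` in the free group on
`x₁, …, x_{2g}`. The letter `x_m` is indexed by the element `m - 1` of `Fin (2 * g)`. -/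
def surfaceRelator (g : ℕ) : FreeGroup (Fin (2 * g)) :=
  (List.ofFn fun r : Fin g =>
    groupComm (FreeGroup.of (⟨2 * r.val, by omega⟩ : Fin (2 * g)))
      (FreeGroup.of (⟨2 * r.val + 1, by omega⟩ : Fin (2 * g)))).prod

/-- The fundamental group of the closed oriented surface of genus `g`, through its standard
presentation `⟨x₁, …, x_{2g} ∣ [x₁, x₂] ⋯ [x_{2g-1}, x_{2g}] = 1⟩`. -/
abbrev SurfaceGroup (g : ℕ) : Type :=
  PresentedGroup ({surfaceRelator g} : Set (FreeGroup (Fin (2 * g))))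

/-- The standard generators of the surface group. -/
def SurfaceGroup.x {g : ℕ} (m : Fin (2 * g)) : SurfaceGroup g :=
  PresentedGroup.of m

/-- The indices of the generating family: pairs `i < j` other than `(x₁, x₂)` (which is the
pair `(0, 1)` in `Fin (2 * g)`), together with an integer `k m` for each `m ≥ i`. -/
structure SurfaceIndex (g : ℕ) where
  i : Fin (2 * g)
  j : Fin (2 * g)
  lt : i < j
  ne : ¬ (i.val = 0 ∧ j.val = 1)
  k : {m : Fin (2 * g) // i ≤ m} → ℤ

/-- The ordered product `x_i ^ k_i * x_{i+1} ^ k_{i+1} * ⋯ * x_{2g} ^ k_{2g}`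
(the positions `m < i` contribute the factor `1`). -/
def surfaceMonomial {g : ℕ} (i : Fin (2 * g)) (k : {m : Fin (2 * g) // i ≤ m} → ℤ) :
    SurfaceGroup g :=
  (List.ofFn fun m : Fin (2 * g) =>
    if h : i ≤ m then SurfaceGroup.x m ^ k ⟨m, h⟩ else 1).prod

/-- The element `[x_i, x_j] ^ (x_i ^ k_i ⋯ x_{2g} ^ k_{2g})` of the surface group. -/
def surfaceGenerator {g : ℕ} (s : SurfaceIndex g) : SurfaceGroup g :=
  groupConj (groupComm (SurfaceGroup.x s.i) (SurfaceGroup.x s.j)) (surfaceMonomial s.i s.k)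

/-! The commutator subgroup is the group of loops at the origin in the abelian cover, whose
1-skeleton is the grid on `ℤ²ᵍ`. The edges in direction `j` at vertices `k` with `k l = 0` for all
`l < j` form a maximal tree. The squares `(i, j)` at vertices with `k l = 0` for `l < i` give a free
basis of the loops of the grid: their labels can be prescribed arbitrarily, and they determine all
edge labels. At each vertex the surface relator expresses the square `(0, 1)` through squares in
directions at least 2, so it eliminates exactly that basis element.

Freeness: label the edges in the free group on the index set so that every relator loop has label 1.
The surface group then maps to `LabelledShift`, and `loopLabel` sends each generator to its own
letter (`loopLabel_surfaceGenerator`).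

Generation: with `t k` the monomial of `k`, every edge element `(t k)⁻¹ * (X m)⁻¹ * t (k + e_m)`
lies in the subgroup generated by the family (`edge_mem_closure`), and elements of the commutator
subgroup are products of such elements and their inverses. -/

theorem prod_map_eq_mul_of_pairwise {α G : Type*} [LinearOrder α] [Monoid G] {f g : α → G} {i : α}
    {s : G} (hf : ∀ l < i, f l = 1) (hg : ∀ l < i, g l = 1) (hi : f i = s * g i)
    (hgt : ∀ l, i < l → f l = g l) {L : List α} (hL : L.Pairwise (· < ·)) (hmem : i ∈ L) :
    (L.map f).prod = s * (L.map g).prod := by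
  induction L with
  | nil => simp at hmem
  | cons a L ih =>
    rw [List.pairwise_cons] at hL
    rcases List.mem_cons.1 hmem with rfl | h
    · have : L.map f = L.map g := List.map_congr_left fun l hl => hgt l (hL.1 l hl)
      simp [this, hi, mul_assoc]
    · have ha := hL.1 i h
      simp [hf a ha, hg a ha, ih hL.2 h]

theorem prod_finRange_eq_mul {n : ℕ} {G : Type*} [Monoid G] {f g : Fin n → G} {i : Fin n} {s : G}
    (hf : ∀ l < i, f l = 1) (hg : ∀ l < i, g l = 1) (hi : f i = s * g i)
    (hgt : ∀ l, i < l → f l = g l) :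
    ((List.finRange n).map f).prod = s * ((List.finRange n).map g).prod :=
  prod_map_eq_mul_of_pairwise hf hg hi hgt (List.pairwise_lt_finRange n) (List.mem_finRange i)

/-- The solution of `p (z + 1) = a z * p z` with `p 0 = 1`. -/
def intProd {G : Type*} [Group G] (a : ℤ → G) : ℤ → G
  | Int.ofNat n => n.rec 1 fun m p => a m * p
  | Int.negSucc n => (n + 1).rec 1 fun m p => (a (-m - 1))⁻¹ * p

theorem intProd_zero {G : Type*} [Group G] (a : ℤ → G) : intProd a 0 = 1 := rfl

theorem intProd_add_one {G : Type*} [Group G] (a : ℤ → G) (z : ℤ) :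
    intProd a (z + 1) = a z * intProd a z := by
  rcases z with n | n
  · rfl
  · have h : ∀ m : ℕ, intProd a (Int.negSucc m) = (a (-m - 1))⁻¹ * intProd a (-m) := by
      intro m
      cases m <;> rfl
    have e : Int.negSucc n = -n - 1 := by omega
    rw [h n, e, mul_inv_cancel_left]
    congr 1
    omega

/-! ### Labelled translations: paths in the cover and their labels -/

/-- Translations `k ↦ k + shift` of `A` with a label in `G` at each point; composing them
multiplies the labels met along the way. -/
@[ext] structure LabelledShift (A G : Type*) where
  label : A → G
  shift : A

namespace LabelledShift

variable {A G : Type*} [AddCommGroup A] [Group G]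

instance : Mul (LabelledShift A G) :=
  ⟨fun p q => ⟨fun k => p.label k * q.label (k + p.shift), p.shift + q.shift⟩⟩

instance : One (LabelledShift A G) := ⟨⟨fun _ => 1, 0⟩⟩

instance : Inv (LabelledShift A G) :=
  ⟨fun p => ⟨fun k => (p.label (k - p.shift))⁻¹, -p.shift⟩⟩

@[simp] theorem mul_label (p q : LabelledShift A G) (k : A) :
    (p * q).label k = p.label k * q.label (k + p.shift) := rfl
@[simp] theorem mul_shift (p q : LabelledShift A G) : (p * q).shift = p.shift + q.shift := rfl
@[simp] theorem one_label (k : A) : (1 : LabelledShift A G).label k = 1 := rfl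
@[simp] theorem one_shift : (1 : LabelledShift A G).shift = 0 := rfl
@[simp] theorem inv_label (p : LabelledShift A G) (k : A) :
    p⁻¹.label k = (p.label (k - p.shift))⁻¹ := rfl
@[simp] theorem inv_shift (p : LabelledShift A G) : p⁻¹.shift = -p.shift := rfl

instance : Group (LabelledShift A G) :=
  Group.ofLeftAxioms
    (fun p q r => by ext <;> simp [mul_assoc, add_assoc])
    (fun p => by ext <;> simp)
    (fun p => by ext <;> simp [← sub_eq_add_neg])

/-- The shift of a product is the sum of the shifts. -/
def shiftHom : LabelledShift A G →* Multiplicative A where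
  toFun p := Multiplicative.ofAdd p.shift
  map_one' := rfl
  map_mul' _ _ := rfl

/-- Labels without a translation. -/
def ofLabel : (A → G) →* LabelledShift A G where
  toFun f := ⟨f, 0⟩
  map_one' := rfl
  map_mul' f g := by ext <;> simp

theorem zpow_shift (p : LabelledShift A G) (z : ℤ) : (p ^ z).shift = z • p.shift :=
  congrArg Multiplicative.toAdd (map_zpow shiftHom p z)

theorem groupComm_inv (p q : LabelledShift A G) :
    groupComm p⁻¹ q⁻¹ = ofLabel fun k =>
      p.label k * q.label (k + p.shift) * (p.label (k + q.shift))⁻¹ * (q.label k)⁻¹ := by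
  ext k
  · simp [groupComm, ofLabel, mul_assoc]
    congr 4 <;> abel_nf
  · simp [groupComm, ofLabel]

theorem zpow_label_eq_one {p : LabelledShift A G} {s : Set A} (hs : ∀ k, k + p.shift ∈ s ↔ k ∈ s)
    (hp : ∀ k ∈ s, p.label k = 1) (z : ℤ) : ∀ k ∈ s, (p ^ z).label k = 1 := by
  induction z with
  | zero => simp
  | succ i ih =>
    intro k hk
    -- Taking the factor `p` first reads its label at `k`; the remaining power starts at `k +
    -- p.shift`, still in `s`.
    rw [zpow_add_one, ← (Commute.self_zpow p i).eq, mul_label, hp k hk, ih _ ((hs k).2 hk), one_mul]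
  | pred i ih =>
    intro k hk
    have hk' : k - p.shift ∈ s := (hs _).1 (by simpa using hk)
    rw [zpow_sub_one, ← ((Commute.self_zpow p _).inv_left).eq, mul_label, inv_label,
      hp _ hk', inv_shift, ← sub_eq_add_neg, ih _ hk', inv_one, one_mul]

end LabelledShift

/-! ### Edge labels of the grid with prescribed square labels -/

section EdgeLabels

variable {n : ℕ} {G : Type*} [Group G]

/-- The label of the edge from `k` to `k + e_j` of the grid `ℤⁿ`, for which the edges with
`k l = 0` for all `l < j` have label `1`, and the square with sides `e_i`, `e_j` at a vertex `k`
with `k l = 0` for `l < i` has label `S i j k`. -/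
def edgeLabel (S : Fin n → Fin n → (Fin n → ℤ) → G) (j : Fin n) (k : Fin n → ℤ) : G :=
  ((List.finRange n).map fun i =>
    if i < j then intProd (fun z => S i j (Function.update k i z)) (k i) else 1).prod

theorem edgeLabel_congr {S S' : Fin n → Fin n → (Fin n → ℤ) → G} {j : Fin n}
    (h : ∀ i < j, S i j = S' i j) (k : Fin n → ℤ) : edgeLabel S j k = edgeLabel S' j k := by
  unfold edgeLabel
  congr 1
  refine List.map_congr_left fun i _ => ?_
  split_ifs with hi
  · rw [h i hi]
  · rfl

theorem edgeLabel_eq_one {S : Fin n → Fin n → (Fin n → ℤ) → G} {j : Fin n} {k : Fin n → ℤ}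
    (h : ∀ l < j, k l = 0) : edgeLabel S j k = 1 := by
  refine List.prod_eq_one fun a ha => ?_
  obtain ⟨i, -, rfl⟩ := List.mem_map.1 ha
  split_ifs with hi
  · rw [h i hi, intProd_zero]
  · rfl

/-- Moving along `e_i` leaves the factors before `i` trivial, advances the recursion of `intProd` in
factor `i` by one, and does not affect later factors, since `hS` makes `S l j` independent of
coordinate `i` for `l > i`. -/
theorem edgeLabel_add_single {S : Fin n → Fin n → (Fin n → ℤ) → G}
    (hS : ∀ i j k k', (∀ m, i ≤ m → k m = k' m) → S i j k = S i j k')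
    {i j : Fin n} (hij : i < j) {k : Fin n → ℤ} (h : ∀ l < i, k l = 0) :
    edgeLabel S j (k + Pi.single i 1) = S i j k * edgeLabel S j k := by
  refine prod_finRange_eq_mul (i := i) (fun l hl => ?_) (fun l hl => ?_) ?_ (fun l hl => ?_)
  · simp [hl.ne, h l hl, intProd_zero]
  · simp [h l hl, intProd_zero]
  · have e : ∀ z, Function.update (k + Pi.single i 1) i z = Function.update k i z := by
      intro z
      ext m
      by_cases hm : m = i
      · subst hm; simp
      · simp [hm]
    simp only [hij, if_true, e, Pi.add_apply, Pi.single_eq_same]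
    rw [intProd_add_one, Function.update_eq_self]
  · split_ifs with hlj
    · have e : (k + Pi.single i 1 : Fin n → ℤ) l = k l := by simp [hl.ne']
      rw [e]
      congr 1
      funext z
      refine hS _ _ _ _ fun m hm => ?_
      have hmi : m ≠ i := (hl.trans_le hm).ne'
      by_cases hml : m = l
      · subst hml; simp
      · simp [hml, hmi]
    · rfl

/-- The generator of the translation along `e_j`, labelled by `edgeLabel S j`. -/
def edgeShift (S : Fin n → Fin n → (Fin n → ℤ) → G) (j : Fin n) : LabelledShift (Fin n → ℤ) G :=
  ⟨edgeLabel S j, Pi.single j 1⟩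

/-- The label of the square with sides `e_i`, `e_j` at `k`. -/
def squareLabel (S : Fin n → Fin n → (Fin n → ℤ) → G) (i j : Fin n) (k : Fin n → ℤ) : G :=
  edgeLabel S i k * edgeLabel S j (k + Pi.single i 1) * (edgeLabel S i (k + Pi.single j 1))⁻¹ *
    (edgeLabel S j k)⁻¹

theorem groupComm_edgeShift (S : Fin n → Fin n → (Fin n → ℤ) → G) (i j : Fin n) :
    groupComm (edgeShift S i)⁻¹ (edgeShift S j)⁻¹ = LabelledShift.ofLabel (squareLabel S i j) :=
  LabelledShift.groupComm_inv _ _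

/-- Both `e_i`-edges of this square lie in the tree, so only the two `e_j`-edges contribute, and
their quotient is the prescribed label. -/
theorem squareLabel_eq {S : Fin n → Fin n → (Fin n → ℤ) → G}
    (hS : ∀ i j k k', (∀ m, i ≤ m → k m = k' m) → S i j k = S i j k')
    {i j : Fin n} (hij : i < j) {k : Fin n → ℤ} (h : ∀ l < i, k l = 0) :
    squareLabel S i j k = S i j k := by
  have h' : ∀ l < i, (k + Pi.single j 1 : Fin n → ℤ) l = 0 := fun l hl => by
    simp [h l hl, (hl.trans hij).ne]
  simp [squareLabel, edgeLabel_eq_one h, edgeLabel_eq_one h', edgeLabel_add_single hS hij h]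

theorem squareLabel_congr {S S' : Fin n → Fin n → (Fin n → ℤ) → G} {i j : Fin n}
    (hi : ∀ l < i, S l i = S' l i) (hj : ∀ l < j, S l j = S' l j) :
    squareLabel S i j = squareLabel S' i j := by
  funext k
  simp only [squareLabel, edgeLabel_congr hi, edgeLabel_congr hj]

/-- Inverting reverses the order: the path from the origin runs through the largest direction first.
When direction `a` is traversed, all coordinates below `a` are still 0, so the path stays in the
tree. -/
theorem prod_edgeShift (S : Fin n → Fin n → (Fin n → ℤ) → G) (k : Fin n → ℤ) {L : List (Fin n)}
    (hL : L.Pairwise (· < ·)) :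
    ((L.map fun m => (edgeShift S m)⁻¹ ^ k m).prod)⁻¹.label 0 = 1 ∧
    ((L.map fun m => (edgeShift S m)⁻¹ ^ k m).prod)⁻¹.shift
      = (L.map fun m => Pi.single m (k m)).sum := by
  induction L with
  | nil => simp
  | cons a L ih =>
    rw [List.pairwise_cons] at hL
    obtain ⟨h1, h2⟩ := ih hL.2
    rw [List.map_cons, List.prod_cons, mul_inv_rev, inv_zpow, inv_inv, LabelledShift.mul_label,
      LabelledShift.mul_shift, h1, h2, LabelledShift.zpow_shift, one_mul, zero_add]
    constructor
    · refine LabelledShift.zpow_label_eq_one (s := {v : Fin n → ℤ | ∀ l < a, v l = 0}) (fun v => ?_)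
        (fun v hv => edgeLabel_eq_one hv) _ _ fun l hl => ?_
      · refine forall₂_congr fun l hl => ?_
        simp [edgeShift, hl.ne]
      · refine (map_list_sum (Pi.evalAddMonoidHom (fun _ => ℤ) l) _).trans ?_
        refine List.sum_eq_zero fun x hx => ?_
        rw [List.map_map, List.mem_map] at hx
        obtain ⟨m, hm, rfl⟩ := hx
        simp [(hl.trans (hL.1 m hm)).ne]
    · rw [List.map_cons, List.sum_cons, add_comm]
      congr 1
      ext l
      by_cases h : l = a
      · subst h; simp [edgeShift]
      · simp [edgeShift, h]

end EdgeLabels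

/-! ### Generation: edge elements along ordered monomials -/

section TailMonomial

variable {n : ℕ} {G : Type*} [Group G] (X : Fin n → G)

/-- The product `X_i ^ k_i * X_{i+1} ^ k_{i+1} * ⋯ * X_{n-1} ^ k_{n-1}`. -/
def tailMonomial (i : ℕ) (k : Fin n → ℤ) : G :=
  ((List.finRange n).map fun m => if i ≤ m.val then X m ^ k m else 1).prod

theorem tailMonomial_congr {i : ℕ} {k k' : Fin n → ℤ} (h : ∀ m : Fin n, i ≤ m.val → k m = k' m) :
    tailMonomial X i k = tailMonomial X i k' := by
  unfold tailMonomial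
  congr 1
  refine List.map_congr_left fun m _ => ?_
  split_ifs with hm
  · rw [h m hm]
  · rfl

theorem tailMonomial_zero (i : ℕ) : tailMonomial X i 0 = 1 :=
  List.prod_eq_one fun a ha => by
    obtain ⟨m, -, rfl⟩ := List.mem_map.1 ha
    simp

theorem tailMonomial_succ (i : Fin n) (k : Fin n → ℤ) :
    tailMonomial X i k = X i ^ k i * tailMonomial X (i + 1) k := by
  refine prod_finRange_eq_mul (i := i) (fun l hl => if_neg ?_) (fun l hl => if_neg ?_) ?_
    (fun l hl => ?_)
  · simpa using hl
  · have : l.val < i.val := hl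
    omega
  · simp
  · have : i.val < l.val := hl
    rw [if_pos (by omega), if_pos (by omega)]

theorem tailMonomial_add_single (i : Fin n) (k : Fin n → ℤ) :
    tailMonomial X i (k + Pi.single i 1) = X i * tailMonomial X i k := by
  have : tailMonomial X (i + 1) (k + Pi.single i 1) = tailMonomial X (i + 1) k :=
    tailMonomial_congr X fun m hm => by
      have : m ≠ i := by rintro rfl; omega
      simp [this]
  rw [tailMonomial_succ, tailMonomial_succ, this]
  simp [zpow_add, ← mul_assoc, (Commute.self_zpow (X i) (k i)).eq]

/-- Starting from `i = m`, where the edge element is 1, the range of coordinates grows downwards.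
Neighbouring edge elements in direction `m` differ by a square element, which `hH` puts in `H`. -/
theorem edge_mem (H : Subgroup G) (m : Fin n)
    (hH : ∀ i < m, ∀ k, groupConj (groupComm (X i) (X m)) (tailMonomial X i k) ∈ H)
    {i : ℕ} (him : i ≤ m) : ∀ k,
    (tailMonomial X i k)⁻¹ * (X m)⁻¹ * tailMonomial X i (k + Pi.single m 1) ∈ H := by
  induction him using Nat.decreasingInduction with
  | self =>
    intro k
    simp [tailMonomial_add_single, mul_assoc, H.one_mem]
  | of_succ i hi ih =>
    let i' : Fin n := ⟨i, hi.trans m.2⟩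
    have hi' : i' < m := hi
    have step (k : Fin n → ℤ) :
        (tailMonomial X i (k + Pi.single i' 1))⁻¹ * (X m)⁻¹ *
          tailMonomial X i (k + Pi.single i' 1 + Pi.single m 1) =
        groupConj (groupComm (X i') (X m)) (tailMonomial X i k) *
          ((tailMonomial X i k)⁻¹ * (X m)⁻¹ * tailMonomial X i (k + Pi.single m 1)) := by
      have h := tailMonomial_add_single X i'
      rw [add_right_comm, h k, h (k + Pi.single m 1)]
      simp only [groupConj, groupComm]
      group
      rfl
    -- Induction on the coordinate `i'` in both directions; at 0 the factor `X i' ^ 0` disappears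
    -- and the claim is that for `i + 1`.
    have key (z : ℤ) (k : Fin n → ℤ) (hk : k i' = z) :
        (tailMonomial X i k)⁻¹ * (X m)⁻¹ * tailMonomial X i (k + Pi.single m 1) ∈ H := by
      induction z generalizing k with
      | zero =>
        have h := tailMonomial_succ X i'
        have := ih k
        simp only [i'] at h
        rw [h k, h (k + Pi.single m 1)]
        simpa [i', hi'.ne, hk] using this
      | succ z hz =>
        have := step (k - Pi.single i' 1)
        rw [sub_add_cancel] at this
        rw [this]
        exact H.mul_mem (hH i' hi' _) (hz _ (by simp [hk]))
      | pred z hz =>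
        have := hz (k + Pi.single i' 1) (by simp [hk])
        rw [step k] at this
        exact (H.mul_mem_cancel_left (hH i' hi' _)).1 this
    exact fun k => key _ k rfl

/-- The square element is the product of the four edge elements around its boundary. -/
theorem square_mem (H : Subgroup G) (t : (Fin n → ℤ) → G) {i j : Fin n}
    (hi : ∀ k, (t k)⁻¹ * (X i)⁻¹ * t (k + Pi.single i 1) ∈ H)
    (hj : ∀ k, (t k)⁻¹ * (X j)⁻¹ * t (k + Pi.single j 1) ∈ H) (k : Fin n → ℤ) :
    groupConj (groupComm (X i) (X j)) (t k) ∈ H := by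
  have := H.mul_mem (H.mul_mem (hi k) (hj (k + Pi.single i 1)))
    (H.inv_mem (H.mul_mem (hj k) (hi (k + Pi.single j 1))))
  rw [add_right_comm] at this
  convert this using 1
  simp only [groupConj, groupComm]
  group

/-- Schreier's rewriting: a word in the `X m` is cut at each letter by inserting `t` and its
inverse. The displacement `v` does not depend on the starting vertex, which is what lets products
and inverses be handled. -/
theorem exists_mul_mem (H : Subgroup G) (t : (Fin n → ℤ) → G)
    (hX : Subgroup.closure (Set.range X) = ⊤)
    (h : ∀ m k, (t k)⁻¹ * (X m)⁻¹ * t (k + Pi.single m 1) ∈ H) (w : G) :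
    ∃ v, ∀ k, (t k)⁻¹ * w * t (k + v) ∈ H := by
  have hw : w ∈ Subgroup.closure (Set.range X) := hX ▸ Subgroup.mem_top w
  induction hw using Subgroup.closure_induction with
  | mem x hx =>
    obtain ⟨m, rfl⟩ := hx
    refine ⟨-Pi.single m 1, fun k => ?_⟩
    have := H.inv_mem (h m (k + -Pi.single m 1))
    rw [neg_add_cancel_right] at this
    convert this using 1
    group
  | one => exact ⟨0, fun k => by simp [H.one_mem]⟩
  | mul x y _ _ hx hy =>
    obtain ⟨v, hv⟩ := hx
    obtain ⟨u, hu⟩ := hy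
    refine ⟨v + u, fun k => ?_⟩
    convert H.mul_mem (hv k) (hu (k + v)) using 1
    rw [add_assoc]
    group
  | inv x _ hx =>
    obtain ⟨v, hv⟩ := hx
    refine ⟨-v, fun k => ?_⟩
    have := H.inv_mem (hv (k + -v))
    rw [neg_add_cancel_right] at this
    convert this using 1
    group

end TailMonomial

/-! ### Commutators and conjugates -/

theorem map_groupComm {G H : Type*} [Group G] [Group H] (f : G →* H) (y z : G) :
    f (groupComm y z) = groupComm (f y) (f z) := by
  simp [groupComm]

theorem map_groupConj {G H : Type*} [Group G] [Group H] (f : G →* H) (y z : G) :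
    f (groupConj y z) = groupConj (f y) (f z) := by
  simp [groupConj]

theorem groupComm_mem_commutator {G : Type*} [Group G] (y z : G) :
    groupComm y z ∈ commutator G := by
  have := Subgroup.commutator_mem_commutator (Subgroup.mem_top y⁻¹) (Subgroup.mem_top z⁻¹)
  simpa [groupComm, commutatorElement_def, commutator_def] using this

theorem groupConj_mem {G : Type*} [Group G] {N : Subgroup G} [N.Normal] {y : G} (hy : y ∈ N)
    (z : G) : groupConj y z ∈ N := by
  simpa [groupConj] using Subgroup.Normal.conj_mem ‹_› y hy z⁻¹

theorem groupConj_list_prod {G : Type*} [Group G] (z : G) (L : List G) :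
    groupConj L.prod z = (L.map fun y => groupConj y z).prod := by
  induction L with
  | nil => simp [groupConj]
  | cons a L ih =>
    rw [List.map_cons, List.prod_cons, List.prod_cons, ← ih]
    simp only [groupConj]
    group

/-! ### The surface group: monomials and the relation -/

namespace SurfaceGroup

variable {g : ℕ}

theorem surfaceMonomial_eq (i : Fin (2 * g)) (k : {m : Fin (2 * g) // i ≤ m} → ℤ)
    (k' : Fin (2 * g) → ℤ) (h : ∀ m : {m : Fin (2 * g) // i ≤ m}, k m = k' m) :
    surfaceMonomial i k = tailMonomial SurfaceGroup.x i k' := by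
  unfold surfaceMonomial tailMonomial
  rw [List.ofFn_eq_map]
  congr 1
  refine List.map_congr_left fun m _ => ?_
  by_cases hm : i ≤ m
  · have hm' : i.val ≤ m.val := hm
    rw [dif_pos hm, if_pos hm', h]
  · have hm' : ¬ i.val ≤ m.val := hm
    rw [dif_neg hm, if_neg hm']

theorem surfaceGenerator_mem_commutator (s : SurfaceIndex g) :
    surfaceGenerator s ∈ commutator (SurfaceGroup g) :=
  groupConj_mem (groupComm_mem_commutator _ _) _

theorem closure_range_x : Subgroup.closure (Set.range (SurfaceGroup.x (g := g))) = ⊤ :=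
  PresentedGroup.closure_range_of _

theorem prod_groupComm_x :
    (List.ofFn fun r : Fin g =>
      groupComm (SurfaceGroup.x (⟨2 * r.val, by omega⟩ : Fin (2 * g)))
        (SurfaceGroup.x (⟨2 * r.val + 1, by omega⟩ : Fin (2 * g)))).prod = 1 := by
  have h : PresentedGroup.mk {surfaceRelator g} (surfaceRelator g) = 1 :=
    PresentedGroup.one_of_mem rfl
  rw [surfaceRelator, map_list_prod, List.map_ofFn] at h
  exact h

/-! ### Freeness: labels that respect the surface relation -/

open Classical in
/-- The labels of the squares: the basis element of the free group with the same index, and `1`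
where there is none. -/
noncomputable def freeSquareLabel (i j : Fin (2 * g)) (k : Fin (2 * g) → ℤ) :
    FreeGroup (SurfaceIndex g) :=
  if h : i < j ∧ ¬ (i.val = 0 ∧ j.val = 1) then
    FreeGroup.of ⟨i, j, h.1, h.2, fun m => k m⟩ else 1

open Classical in
/-- As `freeSquareLabel`, with the labels of the squares in the first two directions changed
so that the surface relator gets the label `1`. -/
noncomputable def solvedSquareLabel (i j : Fin (2 * (g + 1))) (k : Fin (2 * (g + 1)) → ℤ) :
    FreeGroup (SurfaceIndex (g + 1)) :=
  if i.val = 0 ∧ j.val = 1 then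
    ((List.ofFn fun r : Fin g => squareLabel freeSquareLabel
      (⟨2 * (r.val + 1), by omega⟩ : Fin (2 * (g + 1)))
      (⟨2 * (r.val + 1) + 1, by omega⟩ : Fin (2 * (g + 1)))).prod k)⁻¹
  else freeSquareLabel i j k

theorem solvedSquareLabel_congr (i j : Fin (2 * (g + 1))) (k k' : Fin (2 * (g + 1)) → ℤ)
    (h : ∀ m, i ≤ m → k m = k' m) : solvedSquareLabel i j k = solvedSquareLabel i j k' := by
  unfold solvedSquareLabel freeSquareLabel
  split_ifs with h0 h1
  -- Here `i` is 0, so the hypothesis covers every coordinate; the solved label may depend on all of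
  -- `k`.
  · have : k = k' := funext fun m => h m (by
      have := h0.1
      exact Fin.le_def.2 (by omega))
    rw [this]
  · have : (fun m : {m // i ≤ m} => k m) = fun m : {m // i ≤ m} => k' m :=
      funext fun m => h m m.2
    rw [this]
  · rfl

theorem solvedSquareLabel_of_index (s : SurfaceIndex (g + 1)) {k : Fin (2 * (g + 1)) → ℤ}
    (hk : ∀ m : {m // s.i ≤ m}, k m = s.k m) :
    solvedSquareLabel s.i s.j k = FreeGroup.of s := by
  obtain ⟨i, j, lt, ne, k'⟩ := s
  obtain rfl : (fun m : {m // i ≤ m} => k m) = k' := funext hk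
  simp only [solvedSquareLabel, freeSquareLabel]
  rw [if_neg ne, dif_pos ⟨lt, ne⟩]

/-- The surface group acting on the covering with group `ℤ²ᵍ`, with labels in the free group. -/
noncomputable def toLabelledShift : SurfaceGroup (g + 1) →*
    LabelledShift (Fin (2 * (g + 1)) → ℤ) (FreeGroup (SurfaceIndex (g + 1))) :=
  PresentedGroup.toGroup (f := fun m => (edgeShift solvedSquareLabel m)⁻¹) <| by
    rintro _ rfl
    -- These squares use only edges in directions at least 2, whose labels do not involve the
    -- modified `S 0 1`, so solving for it is not circular.
    have h (r : Fin g) : squareLabel solvedSquareLabel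
        (⟨2 * (r.val + 1), by omega⟩ : Fin (2 * (g + 1)))
        (⟨2 * (r.val + 1) + 1, by omega⟩ : Fin (2 * (g + 1))) = squareLabel freeSquareLabel
        (⟨2 * (r.val + 1), by omega⟩ : Fin (2 * (g + 1)))
        (⟨2 * (r.val + 1) + 1, by omega⟩ : Fin (2 * (g + 1))) :=
      squareLabel_congr
        (fun l _ => funext fun k => if_neg fun h => by have := h.2; simp at this)
        (fun l _ => funext fun k => if_neg fun h => by have := h.2; simp at this)
    -- No coordinate precedes 0, so the `(0, 1)` square has its prescribed label at every vertex.
    have h0 : squareLabel solvedSquareLabel (⟨0, by omega⟩ : Fin (2 * (g + 1)))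
        (⟨1, by omega⟩ : Fin (2 * (g + 1))) = ((List.ofFn fun r : Fin g =>
      squareLabel freeSquareLabel (⟨2 * (r.val + 1), by omega⟩ : Fin (2 * (g + 1)))
      (⟨2 * (r.val + 1) + 1, by omega⟩ : Fin (2 * (g + 1)))).prod)⁻¹ := by
      funext k
      rw [squareLabel_eq solvedSquareLabel_congr (Fin.lt_def.2 Nat.zero_lt_one)
        (fun l hl => absurd (Fin.lt_def.1 hl) (Nat.not_lt_zero _))]
      exact if_pos ⟨rfl, rfl⟩
    have e : (⇑(FreeGroup.lift fun m => (edgeShift (solvedSquareLabel (g := g)) m)⁻¹) ∘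
        fun r : Fin (g + 1) => groupComm
          (FreeGroup.of (⟨2 * r.val, by omega⟩ : Fin (2 * (g + 1))))
          (FreeGroup.of (⟨2 * r.val + 1, by omega⟩ : Fin (2 * (g + 1))))) =
        ⇑LabelledShift.ofLabel ∘ fun r : Fin (g + 1) => squareLabel solvedSquareLabel
          (⟨2 * r.val, by omega⟩ : Fin (2 * (g + 1)))
          (⟨2 * r.val + 1, by omega⟩ : Fin (2 * (g + 1))) := by
      funext r
      simp only [Function.comp, map_groupComm, FreeGroup.lift_apply_of, groupComm_edgeShift]
    rw [surfaceRelator, map_list_prod, List.map_ofFn, e, ← List.map_ofFn, ← map_list_prod,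
      List.ofFn_succ, List.prod_cons]
    simp only [Fin.val_succ, h, Fin.val_zero, mul_zero, zero_add]
    rw [h0, inv_mul_cancel, map_one]

theorem toLabelledShift_x (m : Fin (2 * (g + 1))) :
    toLabelledShift (SurfaceGroup.x m) = (edgeShift solvedSquareLabel m)⁻¹ :=
  PresentedGroup.toGroup.of _

theorem toLabelledShift_tailMonomial (i : Fin (2 * (g + 1))) (k : Fin (2 * (g + 1)) → ℤ)
    (hk : ∀ l < i, k l = 0) :
    (toLabelledShift (tailMonomial SurfaceGroup.x i k))⁻¹.label 0 = 1 ∧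
      (toLabelledShift (tailMonomial SurfaceGroup.x i k))⁻¹.shift = k := by
  have e : toLabelledShift (tailMonomial SurfaceGroup.x i k) =
      ((List.finRange _).map fun m => (edgeShift solvedSquareLabel m)⁻¹ ^ k m).prod := by
    rw [tailMonomial, map_list_prod, List.map_map]
    congr 1
    refine List.map_congr_left fun m _ => ?_
    simp only [Function.comp]
    split_ifs with hm
    · rw [map_zpow, toLabelledShift_x]
    · rw [map_one, hk m (by simpa using hm), zpow_zero]
  rw [e]
  obtain ⟨h1, h2⟩ := prod_edgeShift solvedSquareLabel k (List.pairwise_lt_finRange _)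
  refine ⟨h1, h2.trans ?_⟩
  rw [← List.ofFn_eq_map, List.sum_ofFn, Finset.univ_sum_single]

theorem toLabelledShift_shift_of_mem {w : SurfaceGroup (g + 1)}
    (hw : w ∈ commutator (SurfaceGroup (g + 1))) : (toLabelledShift w).shift = 0 :=
  congrArg Multiplicative.toAdd (MonoidHom.mem_ker.1
    (Abelianization.commutator_subset_ker (LabelledShift.shiftHom.comp toLabelledShift) hw))

/-- The label picked up by an element of the commutator subgroup along its loop at the origin. -/
noncomputable def loopLabel :
    commutator (SurfaceGroup (g + 1)) →* FreeGroup (SurfaceIndex (g + 1)) where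
  toFun w := (toLabelledShift (w : SurfaceGroup (g + 1))).label 0
  map_one' := by simp
  map_mul' v w := by simp [toLabelledShift_shift_of_mem v.2]

theorem loopLabel_surfaceGenerator (s : SurfaceIndex (g + 1)) :
    loopLabel ⟨surfaceGenerator s, surfaceGenerator_mem_commutator s⟩ = FreeGroup.of s := by
  let k : Fin (2 * (g + 1)) → ℤ := fun m => if h : s.i ≤ m then s.k ⟨m, h⟩ else 0
  have hk : ∀ m : {m // s.i ≤ m}, k m = s.k m := fun m => dif_pos m.2
  have hk0 : ∀ l < s.i, k l = 0 := fun l hl => dif_neg hl.not_ge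
  obtain ⟨h1, h2⟩ := toLabelledShift_tailMonomial s.i k hk0
  change (toLabelledShift (surfaceGenerator s)).label 0 = _
  rw [surfaceGenerator, surfaceMonomial_eq s.i s.k k fun m => (hk m).symm, map_groupConj,
    map_groupComm, toLabelledShift_x, toLabelledShift_x, groupComm_edgeShift, groupConj]
  generalize toLabelledShift (tailMonomial SurfaceGroup.x s.i k) = P at h1 h2 ⊢
  -- `P⁻¹` leads from 0 to `k` with label 1, so the way back has label 1 too and the conjugation
  -- contributes nothing.
  have h3 : P.label k = 1 := by
    have : (P⁻¹ * P).label 0 = 1 := by rw [inv_mul_cancel]; rfl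
    rwa [LabelledShift.mul_label, h1, h2, one_mul, zero_add] at this
  rw [LabelledShift.mul_label, LabelledShift.mul_label, LabelledShift.mul_shift, h1, h2, zero_add,
    one_mul]
  simp only [LabelledShift.ofLabel, MonoidHom.coe_mk, OneHom.coe_mk, add_zero, h3, mul_one, zero_add]
  rw [squareLabel_eq solvedSquareLabel_congr s.lt hk0, solvedSquareLabel_of_index s hk]

/-! ### Generation of the commutator subgroup -/

theorem groupConj_mem_closure_of_ne (i j : Fin (2 * g)) (hij : i < j)
    (h : ¬ (i.val = 0 ∧ j.val = 1)) (k : Fin (2 * g) → ℤ) :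
    groupConj (groupComm (SurfaceGroup.x i) (SurfaceGroup.x j)) (tailMonomial SurfaceGroup.x i k) ∈
      Subgroup.closure (Set.range (surfaceGenerator (g := g))) := by
  refine Subgroup.subset_closure ⟨⟨i, j, hij, h, fun m => k m⟩, ?_⟩
  rw [surfaceGenerator, surfaceMonomial_eq _ _ k fun _ => rfl]

/-- Only direction 1 needs the missing pair `(0, 1)`. The other directions come first; they give the
squares `(2r, 2r + 1)` with `r ≥ 1` at every vertex, and the conjugated surface relation then yields
the `(0, 1)` square. -/
theorem edge_mem_closure (m : Fin (2 * (g + 1))) (k : Fin (2 * (g + 1)) → ℤ) :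
    (tailMonomial SurfaceGroup.x 0 k)⁻¹ * (SurfaceGroup.x m)⁻¹ *
      tailMonomial SurfaceGroup.x 0 (k + Pi.single m 1) ∈
      Subgroup.closure (Set.range (surfaceGenerator (g := g + 1))) := by
  have hne (m : Fin (2 * (g + 1))) (hm : m.val ≠ 1) (k : Fin (2 * (g + 1)) → ℤ) :=
    edge_mem SurfaceGroup.x _ m
      (fun i hi k => groupConj_mem_closure_of_ne i m hi (fun h => hm h.2) k) (Nat.zero_le _) k
  by_cases hm : m.val = 1
  · refine edge_mem SurfaceGroup.x _ m (fun i hi k => ?_) (Nat.zero_le _) k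
    obtain rfl : m = ⟨1, by clear * -; omega⟩ := Fin.ext hm
    obtain rfl : i = ⟨0, by clear * -; omega⟩ := Fin.ext (by have : i.val < 1 := hi; simpa using this)
    have hr : groupConj _ (tailMonomial SurfaceGroup.x 0 k) = groupConj 1 _ :=
      congrArg (fun y => groupConj y (tailMonomial SurfaceGroup.x 0 k))
        (prod_groupComm_x (g := g + 1))
    rw [groupConj_list_prod, List.ofFn_succ, List.map_cons, List.prod_cons,
      show groupConj (1 : SurfaceGroup (g + 1)) (tailMonomial SurfaceGroup.x 0 k) = 1 by
        simp [groupConj]] at hr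
    refine Set.mem_of_eq_of_mem (eq_inv_of_mul_eq_one_left hr)
      (Subgroup.inv_mem _ (Subgroup.list_prod_mem _ ?_))
    simp only [List.map_ofFn, List.mem_ofFn, forall_exists_index]
    rintro _ r rfl
    exact square_mem SurfaceGroup.x _ _ (hne _ (by simp)) (hne _ (by simp)) k
  · exact hne m hm k

theorem closure_range_surfaceGenerator :
    Subgroup.closure (Set.range (surfaceGenerator (g := g + 1))) =
      commutator (SurfaceGroup (g + 1)) := by
  have hle : Subgroup.closure (Set.range (surfaceGenerator (g := g + 1))) ≤
      commutator (SurfaceGroup (g + 1)) := by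
    rw [Subgroup.closure_le]
    rintro _ ⟨s, rfl⟩
    exact surfaceGenerator_mem_commutator s
  refine le_antisymm hle fun w hw => ?_
  obtain ⟨v, hv⟩ := exists_mul_mem SurfaceGroup.x
    (Subgroup.closure (Set.range (surfaceGenerator (g := g + 1)))) (tailMonomial SurfaceGroup.x 0)
    closure_range_x edge_mem_closure w
  have h0 := hv 0
  rw [tailMonomial_zero, inv_one, one_mul, zero_add] at h0
  -- Both `w` and its product with the monomial of `v` are in the commutator subgroup, hence so is
  -- the monomial; its inverse has shift `v`, which must vanish.
  have hz : v = 0 := by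
    have h := toLabelledShift_shift_of_mem
      (Subgroup.inv_mem _ ((Subgroup.mul_mem_cancel_left _ hw).1 (hle h0)))
    rw [map_inv] at h
    exact ((toLabelledShift_tailMonomial (⟨0, by omega⟩ : Fin (2 * (g + 1))) v
      fun l hl => absurd (Fin.lt_def.1 hl) (Nat.not_lt_zero _)).2).symm.trans h
  rwa [hz, tailMonomial_zero, mul_one] at h0

/-- The homomorphism from the free group to the commutator subgroup given by the generators. -/
noncomputable def ofFreeGroup : FreeGroup (SurfaceIndex g) →* commutator (SurfaceGroup g) :=
  FreeGroup.lift fun s => ⟨surfaceGenerator s, surfaceGenerator_mem_commutator s⟩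

theorem ofFreeGroup_bijective : Function.Bijective (ofFreeGroup (g := g + 1)) := by
  constructor
  · have : loopLabel.comp ofFreeGroup = MonoidHom.id (FreeGroup (SurfaceIndex (g + 1))) := by
      ext s
      simp [ofFreeGroup, loopLabel_surfaceGenerator]
    exact Function.LeftInverse.injective (g := loopLabel) (DFunLike.congr_fun this)
  · rintro ⟨w, hw⟩
    have hr : Subgroup.closure (Set.range (surfaceGenerator (g := g + 1))) ≤
        ((commutator (SurfaceGroup (g + 1))).subtype.comp ofFreeGroup).range := by
      rw [Subgroup.closure_le]
      rintro _ ⟨s, rfl⟩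
      exact ⟨FreeGroup.of s, by simp [ofFreeGroup]⟩
    obtain ⟨f, hf⟩ := hr (closure_range_surfaceGenerator ▸ hw)
    exact ⟨f, Subtype.ext hf⟩

end SurfaceGroup

/-- For `g ≥ 1`, the commutator subgroup of the surface group is free, and the family
`[x_i, x_j] ^ (x_i ^ k_i ⋯ x_{2g} ^ k_{2g})`, with `i < j` and `(i, j) ≠ (1, 2)`, is a free basis
of it (in particular its members are pairwise distinct and lie in the commutator subgroup). -/
theorem theoremB (g : ℕ) (hg : 1 ≤ g) :
    ∃ b : FreeGroupBasis (SurfaceIndex g) (commutator (SurfaceGroup g)),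
      ∀ s : SurfaceIndex g, (b s : SurfaceGroup g) = surfaceGenerator s := by
  obtain ⟨g, rfl⟩ := Nat.exists_eq_add_of_le' hg
  refine ⟨.ofRepr (MulEquiv.ofBijective _ SurfaceGroup.ofFreeGroup_bijective).symm, fun s => ?_⟩
  change (SurfaceGroup.ofFreeGroup (FreeGroup.of s) : SurfaceGroup (g + 1)) = _
  simp [SurfaceGroup.ofFreeGroup]
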